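/- Let $q$ be a prime power, $\mathbb{F}$ a finite field with $q^2$ elements, and $H$ the affine Hermitian curve $Y^q+Y=X^{q+1}$ over $\mathbb{F}$, with coordinate ring $R=\mathbb{F}[X,Y]/\langle Y^q+Y-X^{q+1}\rangle$, function field $K(H)=\mathrm{Frac}(R)$ and rational points $P_1,\dots,P_n$ ($n=q^3$). Let $P_\infty$ be the unique point at infinity of the (smooth) projective closure of $H$, let $v_{P_\infty}$ be the normalized discrete valuation of $K(H)$ at $P_\infty$, and for an integer $u>0$ let $\mathcal{L}(uP_\infty)=\{\phi\in K(H)\mid \phi=0 \text{ or } (\phi)+uP_\infty\ge 0\}\subset R$. Let $\mathrm{ev}:R\to\mathbb{F}^n$, $\phi\mapsto(\phi(P_1),\dots,\phi(P_n))$, and let the Hermitian code $C_u$ be the image of $\mathcal{L}(uP_\infty)$ under $\mathrm{ev}$. Let $M=[m_{i\gamma}\mid 1\le i\le n,\ \gamma\in\mathbb{F}]$ be a family of nonnegative integers. For $f\in R[z]$ and $S=(P_i,\gamma)$ let $\mathfrak{m}_S=\{h\in R[z]\mid h(P_i,\gamma)=0\}$ and let $\mathrm{mult}_S(f)$ be the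 largest $r$ with $f\in\mathfrak{m}_S^r$ (and $\infty$ if $f=0$). Put $$I_M=\{f\in R[z]\mid \mathrm{mult}_{(P_i,\gamma)}(f)\ge m_{i\gamma}\text{ for all } 1\le i\le n,\ \gamma\in\mathbb{F}\}.$$ For $v=(v_1,\dots,v_n)\in\mathbb{F}^n$ let $\mathrm{score}_M(v)=\sum_{i=1}^n m_{i v_i}$, and for $f=\sum_i\psi_i z^i\in R[z]$ with $\psi_i\in R$ let $\deg_u(f)=\max_i\bigl(-v_{P_\infty}(\psi_i)+ui\bigr)$, where $-v_{P_\infty}(0)=-\infty$. Suppose $f\in I_M$ is nonzero. If a codeword $c=\mathrm{ev}(\mu)$ of $C_u$ with $\mu\in\mathcal{L}(uP_\infty)$ satisfies $\mathrm{score}_M(c)>\deg_u(f)$, then $f(\mu)=0$ in $R$, where $f(\mu)$ is the result of substituting $\mu$ for $z$ in $f$. -/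

import Mathlib

open Polynomial
open scoped WithZero

namespace Hermitian

noncomputable section

variable (F : Type*) [Field F] (q : ℕ)

/-! ### The Hermitian curve -/

/-- The polynomial `Y ^ q + Y - X ^ (q + 1)`, as a polynomial in `Y` over `F[X]`. -/
def poly : F[X][X] := X ^ q + X - C (X ^ (q + 1))

/-- The coordinate ring `R = F[X, Y] / ⟨Y ^ q + Y - X ^ (q + 1)⟩` of the affine curve `H`. -/
abbrev CoordRing : Type _ := AdjoinRoot (poly F q)

/-- The coordinate function `x`. -/
def x : CoordRing F q := AdjoinRoot.of (poly F q) X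

/-- The coordinate function `y`. -/
def y : CoordRing F q := AdjoinRoot.root (poly F q)

variable {F q} in
lemma poly_eval₂ {A : Type*} [CommRing A] (φ : F[X] →+* A) (b : A) :
    (poly F q).eval₂ φ b = b ^ q + b - φ X ^ (q + 1) := by
  rw [poly, eval₂_sub, eval₂_add, eval₂_C, eval₂_pow, eval₂_X, map_pow]

variable {F q} in
/-- The homomorphism out of `R` with `x ↦ a`, `y ↦ b`, for a solution `(a, b)` of the equation of
the curve. -/
def liftHom {A : Type*} [CommRing A] [Algebra F A] (a b : A) (h : b ^ q + b = a ^ (q + 1)) :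
    CoordRing F q →ₐ[F] A :=
  AdjoinRoot.liftAlgHom (poly F q) (aeval a) b (by simp [poly_eval₂, h])

variable {F q} in
@[simp] lemma liftHom_x {A : Type*} [CommRing A] [Algebra F A] (a b : A)
    (h : b ^ q + b = a ^ (q + 1)) : liftHom a b h (x F q) = a := by
  simp [liftHom, x]

variable {F q} in
@[simp] lemma liftHom_y {A : Type*} [CommRing A] [Algebra F A] (a b : A)
    (h : b ^ q + b = a ^ (q + 1)) : liftHom a b h (y F q) = b := by
  simp [liftHom, y]

lemma curve_eq : y F q ^ q + y F q = x F q ^ (q + 1) := by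
  exact sub_eq_zero.1 ((poly_eval₂ _ _).symm.trans (AdjoinRoot.eval₂_root (poly F q)))

variable {F q} in
lemma algHom_ext {A : Type*} [CommRing A] [Algebra F A] {f g : CoordRing F q →ₐ[F] A}
    (hx : f (x F q) = g (x F q)) (hy : f (y F q) = g (y F q)) : f = g := by
  apply AdjoinRoot.algHom_ext' _ hy
  apply Polynomial.algHom_ext
  simpa [x] using hx

section Domain

lemma one_lt_q [Finite F] [hF : Fact (Nat.card F = q ^ 2)] : 1 < q := by
  have h := hF.out ▸ Finite.one_lt_card (α := F)
  by_contra hq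
  interval_cases q <;> simp at h

lemma poly_natDegree (hq : 1 < q) : (poly F q).natDegree = q ∧ (poly F q).Monic := by
  have e : poly F q = X ^ q + (X - C (X ^ (q + 1))) := by simp [poly, add_sub_assoc]
  have hd : (X - C (X ^ (q + 1)) : F[X][X]).degree < q := by
    rw [degree_X_sub_C]; exact_mod_cast hq
  refine ⟨?_, ?_⟩
  · rw [e, natDegree_add_eq_left_of_degree_lt (by rwa [degree_X_pow]), natDegree_X_pow]
  · rw [e]; exact monic_X_pow_add hd

lemma poly_irreducible (hq : 1 < q) : Irreducible (poly F q) := by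
  have e : Bivariate.swap (poly F q) = -(X ^ (q + 1) - C (X ^ q + X)) := by
    simp only [poly, map_sub, map_add, map_pow, Bivariate.swap_Y, Bivariate.swap_X]
    ring
  rw [← MulEquiv.irreducible_iff (Bivariate.swap (R := F)), e,
    (Associated.neg_left (Associated.refl (X ^ (q + 1) - C (X ^ q + X) : F[X][X]))).irreducible_iff]
  have hm : (X ^ (q + 1) - C (X ^ q + X) : F[X][X]).Monic := monic_X_pow_sub_C _ (by omega)
  have hd : (X ^ (q + 1) - C (X ^ q + X) : F[X][X]).natDegree = q + 1 := natDegree_X_pow_sub_C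
  have hpr : (Ideal.span {(X : F[X])}).IsPrime :=
    (Ideal.span_singleton_prime X_ne_zero).2 prime_X
  refine IsEisensteinAt.irreducible (𝓟 := Ideal.span {(X : F[X])}) ?_ hpr hm.isPrimitive
    (by omega)
  refine ⟨?_, ?_, ?_⟩
  · rw [hm.leadingCoeff]
    exact fun h => hpr.ne_top ((Ideal.eq_top_iff_one _).2 h)
  · intro n hn
    rw [hd] at hn
    rw [coeff_sub, coeff_X_pow, if_neg hn.ne, coeff_C, zero_sub, neg_mem_iff]
    split_ifs
    · exact add_mem (Ideal.pow_mem_of_mem _ (Ideal.mem_span_singleton_self _) _ (by omega))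
        (Ideal.mem_span_singleton_self _)
    · exact zero_mem _
  · rw [coeff_sub, coeff_X_pow, if_neg (by omega), coeff_C_zero, zero_sub, neg_mem_iff,
      Ideal.span_singleton_pow, Ideal.mem_span_singleton, X_pow_dvd_iff]
    intro h
    have := h 1 (by omega)
    simp [coeff_X_pow, (show (1 : ℕ) ≠ q by omega)] at this

variable [Finite F] [hF : Fact (Nat.card F = q ^ 2)]

instance : IsDomain (CoordRing F q) :=
  AdjoinRoot.isDomain_of_prime (poly_irreducible F q (one_lt_q F q)).prime

instance : Algebra.FormallyUnramified F[X] (CoordRing F q) := by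
  have hq := one_lt_q F q
  obtain ⟨p, hp⟩ := CharP.exists F
  have hpp : p.Prime := CharP.char_is_prime F p
  have : Fact p.Prime := ⟨hpp⟩
  obtain ⟨k, hk⟩ : ∃ k, q = p ^ k := by
    have := Fintype.ofFinite F
    obtain ⟨n, -, hn⟩ := FiniteField.card F p
    rw [← Nat.card_eq_fintype_card, hF.out] at hn
    obtain ⟨k, -, hk⟩ := (Nat.dvd_prime_pow hpp).1 (hn ▸ dvd_pow_self q two_ne_zero)
    exact ⟨k, hk⟩
  rw [Algebra.FormallyUnramified.iff_comp_injective]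
  intro B _ _ I hI f g hfg
  apply AdjoinRoot.algHom_ext
  have hroot : ∀ h : CoordRing F q →ₐ[F[X]] B, h (y F q) ^ q + h (y F q)
      = algebraMap F[X] B X ^ (q + 1) := by
    intro h
    rw [← map_pow, ← map_add, curve_eq, map_pow]
    congr 1
    exact h.commutes X
  have h1 : f (y F q) - g (y F q) ∈ I := by
    rw [← Ideal.Quotient.eq]
    exact DFunLike.congr_fun hfg (y F q)
  have h2 : (f (y F q) - g (y F q)) ^ q = 0 := by
    have : (f (y F q) - g (y F q)) ^ 2 ∈ I ^ 2 := Ideal.pow_mem_pow h1 2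
    rw [hI] at this
    exact pow_eq_zero_of_le hq this
  rcases subsingleton_or_nontrivial B with hB | hB
  · exact Subsingleton.elim _ _
  let i : F →+* B := (algebraMap F[X] B).comp C
  have : CharP B p := (RingHom.charP_iff i i.injective p).1 hp
  have h4 := sub_pow_char_pow (f (y F q)) (g (y F q)) (p := p) (n := k)
  rw [← hk, h2] at h4
  have h3 := (hroot f).trans (hroot g).symm
  have : f (y F q) - g (y F q) = 0 := by linear_combination h3 + h4
  exact sub_eq_zero.1 this

/-- The affine Hermitian curve is smooth. -/
instance : IsDedekindDomain (CoordRing F q) := by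
  have := (poly_natDegree F q (one_lt_q F q)).2.finite_adjoinRoot
  exact isDedekindDomain.of_formallyUnramified F[X] (CoordRing F q)

end Domain

/-! ### The function field and the place at infinity -/

section Infinity

variable [Finite F] [hF : Fact (Nat.card F = q ^ 2)]

/-- The function field `K(H)`. -/
abbrev FunField : Type _ := FractionRing (CoordRing F q)

lemma y_ne_zero : y F q ≠ 0 := by
  have h := one_lt_q F q
  obtain ⟨h1, h2⟩ := poly_natDegree F q h
  rw [y, ← AdjoinRoot.mk_X]
  exact AdjoinRoot.mk_ne_zero_of_natDegree_lt h2 X_ne_zero (by rw [h1]; simpa using h)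

lemma x_ne_zero : x F q ≠ 0 := by
  have h := one_lt_q F q
  obtain ⟨h1, h2⟩ := poly_natDegree F q h
  rw [x, ← AdjoinRoot.mk_C]
  exact AdjoinRoot.mk_ne_zero_of_natDegree_lt h2 (by simp) (by rw [h1]; simp; omega)

/-- The origin `(0, 0)` of the affine curve, as a prime of `R`. -/
def origin : IsDedekindDomain.HeightOneSpectrum (CoordRing F q) where
  asIdeal := RingHom.ker (liftHom (F := F) (q := q) (0 : F) 0
    (by simp [(zero_lt_one.trans (one_lt_q F q)).ne']))
  isPrime := RingHom.ker_isPrime _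
  ne_bot h := y_ne_zero F q (by
    have : y F q ∈ RingHom.ker (liftHom (F := F) (q := q) (0 : F) 0
      (by simp [(zero_lt_one.trans (one_lt_q F q)).ne'])) := by simp [RingHom.mem_ker]
    simpa [h] using this)

lemma inv_curve_eq {K : Type*} [Field K] {q : ℕ} {a b : K} (hb : b ≠ 0)
    (h : b ^ q + b = a ^ (q + 1)) : (1 / b) ^ q + 1 / b = (a / b) ^ (q + 1) := by
  rw [div_pow a, ← h, eq_div_iff (pow_ne_zero _ hb)]
  have : ((1 / b) ^ q + 1 / b) * b ^ (q + 1)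
      = ((1 / b) * b) ^ q * b + ((1 / b) * b) * b ^ q := by ring
  rw [this, one_div_mul_cancel hb]
  ring

/-- The chart at infinity. The projective closure of `H` is `Y ^ q * Z + Y * Z ^ q = X ^ (q + 1)`;
its only point with `Z = 0` is `P_∞ = (0 : 1 : 0)`, and in the affine coordinates `s = X / Y = x / y`,
`t = Z / Y = 1 / y` around it the curve is `t ^ q + t = s ^ (q + 1)`, with `P_∞` at `s = t = 0`.
This is the homomorphism `R → K(H)` with `x ↦ x / y` and `y ↦ 1 / y`. -/
def chartHom : CoordRing F q →ₐ[F] FunField F q :=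
  liftHom (algebraMap _ (FunField F q) (x F q) / algebraMap _ _ (y F q))
    (1 / algebraMap _ _ (y F q)) (by
      have hy : algebraMap _ (FunField F q) (y F q) ≠ 0 := by
        simpa using y_ne_zero F q
      have h := congrArg (algebraMap _ (FunField F q)) (curve_eq F q)
      simp only [map_add, map_pow] at h
      exact inv_curve_eq hy h)

lemma chartHom_injective : Function.Injective (chartHom F q) := by
  let L := Localization.Away (y F q)
  let j : CoordRing F q →ₐ[F] L := Algebra.ofId (CoordRing F q) L |>.restrictScalars F
  have hj : ∀ r, j r = algebraMap _ L r := fun r => rfl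
  let t : L := IsLocalization.Away.invSelf (y F q)
  have ht : j (y F q) * t = 1 := IsLocalization.Away.mul_invSelf (y F q)
  have h := congrArg j (curve_eq F q)
  simp only [map_add, map_pow] at h
  have hst : t ^ q + t = (j (x F q) * t) ^ (q + 1) := by
    rw [mul_pow, ← h]
    have : (j (y F q) ^ q + j (y F q)) * t ^ (q + 1)
        = (j (y F q) * t) ^ q * t + (j (y F q) * t) * t ^ q := by ring
    rw [this, ht]; ring
  let s : CoordRing F q →ₐ[F] L := liftHom _ _ hst
  have hs : ∀ m : Submonoid.powers (y F q), IsUnit (s m) := by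
    rintro ⟨_, n, rfl⟩
    rw [map_pow]
    exact (IsUnit.of_mul_eq_one (j (y F q)) (by simp [s, mul_comm t, ht])).pow n
  let τ : L →ₐ[F] L := IsLocalization.liftAlgHom (M := Submonoid.powers (y F q)) (f := s) hs
  have hτ : ∀ r, τ (j r) = s r := fun r => IsLocalization.lift_eq _ r
  have hτt : τ t = j (y F q) := by
    have h1 : t * τ t = 1 := by
      have := congrArg τ ht
      rw [map_mul, hτ, map_one] at this
      simpa [s] using this
    calc τ t = (j (y F q) * t) * τ t := by rw [ht, one_mul]
      _ = j (y F q) * (t * τ t) := by ring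
      _ = j (y F q) := by rw [h1, mul_one]
  have hτs : τ.comp s = j := by
    apply algHom_ext
    · simp only [AlgHom.comp_apply, s, liftHom_x, map_mul, hτ, hτt]
      rw [mul_assoc, mul_comm t, ht, mul_one]
    · simp [s, hτt]
  have hle : Submonoid.powers (y F q) ≤ nonZeroDivisors (CoordRing F q) :=
    powers_le_nonZeroDivisors_of_noZeroDivisors (y_ne_zero F q)
  have hjinj : Function.Injective j := IsLocalization.injective L hle
  have hsinj : Function.Injective s := by
    intro a b hab
    apply hjinj
    rw [← hτs, AlgHom.comp_apply, AlgHom.comp_apply, hab]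
  let i : CoordRing F q →ₐ[F] FunField F q :=
    Algebra.ofId (CoordRing F q) (FunField F q) |>.restrictScalars F
  have hi : Function.Injective i := IsFractionRing.injective (CoordRing F q) (FunField F q)
  have hiu : ∀ m : Submonoid.powers (y F q), IsUnit (i m) := fun m =>
    IsUnit.mk0 _ ((map_ne_zero_iff _ hi).2 (nonZeroDivisors.ne_zero (hle m.2)))
  let κ : L →ₐ[F] FunField F q := IsLocalization.liftAlgHom (M := Submonoid.powers (y F q)) hiu
  have hκ : ∀ r, κ (j r) = i r := fun r => IsLocalization.lift_eq _ r
  have hκinj : Function.Injective κ := by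
    refine (IsLocalization.lift_injective_iff (M := Submonoid.powers (y F q)) _).2 fun a b => ?_
    exact hjinj.eq_iff.trans hi.eq_iff.symm
  have hκt : κ t = 1 / i (y F q) := by
    have hy : i (y F q) ≠ 0 := (map_ne_zero_iff _ hi).2 (y_ne_zero F q)
    rw [eq_div_iff hy, ← hκ, ← map_mul, mul_comm, ht, map_one]
  have hκs : κ.comp s = chartHom F q := by
    apply algHom_ext
    · simp only [AlgHom.comp_apply, s, chartHom, liftHom_x, map_mul, hκ, hκt]
      exact mul_one_div _ _
    · simp only [AlgHom.comp_apply, s, chartHom, liftHom_y, hκt]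
      rfl
  rw [← hκs]
  exact hκinj.comp hsinj

/-- The extension `K(H) → K(H)` of `chartHom`: it rewrites a function in the coordinates
`s = x / y`, `t = 1 / y` of the chart at infinity. -/
def chart : FunField F q →ₐ[F] FunField F q :=
  IsFractionRing.liftAlgHom (chartHom_injective F q)

/-- The valuation of `K(H)` at `P_∞`, written multiplicatively: the value of `f ≠ 0` is
`exp (-v_{P_∞}(f))`. It is the valuation at the origin of the chart at infinity; since that chart
has the same equation as `H` and the change of coordinates `chart` is an involution, the expansion
of `f` in `s, t` is read off by applying `chart`. -/
def valInfty : Valuation (FunField F q) ℤᵐ⁰ :=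
  ((origin F q).valuation (FunField F q)).comap (chart F q).toRingHom

/-- The normalized discrete valuation `v_{P_∞}(f)` of a nonzero function `f` as an integer. (The
value at `f = 0`, which should be `∞`, is the unused value `0`.) -/
def vInfty (f : FunField F q) : ℤ := -WithZero.log (valInfty F q f)

/-- The space `𝓛(u P_∞)` of all `f` with `f = 0` or `(f) + u P_∞ ≥ 0`: functions that are regular
at every closed point of the affine curve `H` (the nonzero primes of `R`), and whose multiplicative
valuation at `P_∞` is at most `exp u`, that is, `v_{P_∞}(f) ≥ -u`. -/
def LSpace (u : ℕ) : Submodule F (FunField F q) where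
  carrier := {f | (∀ P : IsDedekindDomain.HeightOneSpectrum (CoordRing F q),
    P.valuation (FunField F q) f ≤ 1) ∧ valInfty F q f ≤ WithZero.exp (u : ℤ)}
  zero_mem' := by simp
  add_mem' {f g} hf hg := ⟨fun P => (Valuation.map_add_le _ (hf.1 P) (hg.1 P)),
    Valuation.map_add_le _ hf.2 hg.2⟩
  smul_mem' a f hf := by
    have e : algebraMap F (FunField F q) a
        = algebraMap (CoordRing F q) (FunField F q) (algebraMap F _ a) :=
      IsScalarTower.algebraMap_apply F (CoordRing F q) (FunField F q) a
    have ha : ∀ P : IsDedekindDomain.HeightOneSpectrum (CoordRing F q),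
        P.valuation (FunField F q) (algebraMap F _ a) ≤ 1 := fun P => by
      rw [e]; exact P.valuation_le_one _
    have hb : valInfty F q (algebraMap F _ a) ≤ 1 := by
      have : valInfty F q (algebraMap F _ a) = (origin F q).valuation (FunField F q)
        (chart F q (algebraMap F _ a)) := rfl
      rw [this, AlgHom.commutes]
      exact ha _
    refine ⟨fun P => ?_, ?_⟩
    · rw [Algebra.smul_def, map_mul]
      exact mul_le_one' (ha P) (hf.1 P)
    · rw [Algebra.smul_def, map_mul]
      exact mul_le_of_le_one_of_le hb hf.2

end Infinity

/-! ### Hermitian codes -/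

/-- The rational points `P_1, ..., P_n` of the affine curve `H`, as pairs `(α, β)`. They serve as
the index set of the coordinates of vectors in `F ^ n`. -/
def Point : Type _ := {P : F × F // P.2 ^ q + P.2 = P.1 ^ (q + 1)}

instance [Finite F] : Finite (Point F q) := Subtype.finite

instance [Finite F] : Fintype (Point F q) := Fintype.ofFinite _

variable {F q}

/-- The value `φ(P)` of `φ ∈ R` at a rational point `P`. -/
def evalAt (P : Point F q) : CoordRing F q →ₐ[F] F := liftHom P.1.1 P.1.2 P.2

variable (F q) in
/-- The evaluation map `ev : R → F ^ n`. -/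
def ev : CoordRing F q →ₗ[F] (Point F q → F) := LinearMap.pi fun P => (evalAt P).toLinearMap

variable (F q) in
/-- The Hermitian code `C_u`, the image of `𝓛(u P_∞)` under `ev`. -/
def code [Finite F] [Fact (Nat.card F = q ^ 2)] (u : ℕ) : Submodule F (Point F q → F) :=
  ((LSpace F q u).comap
    (IsScalarTower.toAlgHom F (CoordRing F q) (FunField F q)).toLinearMap).map (ev F q)

/-! ### Multiplicities, interpolation ideal, score, weighted degree -/

/-- The maximal ideal `𝔪_S` of `R[z]` at the rational point `S = (P, γ)` of `H × 𝔸¹`: all `f` with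
`f(P, γ) = 0`. -/
def maxIdeal (P : Point F q) (γ : F) : Ideal (CoordRing F q)[X] :=
  RingHom.ker (eval₂RingHom (evalAt P : CoordRing F q →+* F) γ)

/-- The multiplicity of `f` at `(P, γ)`: the largest `r` with `f ∈ 𝔪 ^ r` (and `∞` for `f = 0`). -/
def mult (P : Point F q) (γ : F) (f : (CoordRing F q)[X]) : ℕ∞ :=
  ⨆ (r : ℕ) (_ : f ∈ maxIdeal P γ ^ r), (r : ℕ∞)

lemma le_mult_iff (P : Point F q) (γ : F) (f : (CoordRing F q)[X]) (m : ℕ) :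
    (m : ℕ∞) ≤ mult P γ f ↔ f ∈ maxIdeal P γ ^ m := by
  refine ⟨fun h => ?_, fun h => le_iSup₂_of_le m h le_rfl⟩
  by_contra hf
  have hm : m ≠ 0 := by rintro rfl; simp at hf
  have : mult P γ f ≤ ((m - 1 : ℕ) : ℕ∞) := by
    refine iSup₂_le fun r hr => ?_
    by_contra hlt
    have hlt' : m - 1 < r := by exact_mod_cast not_le.1 hlt
    exact hf (Ideal.pow_le_pow_right (by omega) hr)
  have h' : m ≤ m - 1 := by exact_mod_cast h.trans this
  omega

/-- The interpolation ideal `I_M` of the multiplicity matrix `M = [m_{P, γ}]`. -/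
def interpIdeal (M : Point F q → F → ℕ) : Ideal (CoordRing F q)[X] where
  carrier := {f | ∀ P γ, (M P γ : ℕ∞) ≤ mult P γ f}
  zero_mem' P γ := (le_mult_iff ..).2 (zero_mem _)
  add_mem' hf hg P γ := (le_mult_iff ..).2
    (add_mem ((le_mult_iff ..).1 (hf P γ)) ((le_mult_iff ..).1 (hg P γ)))
  smul_mem' a _ hf P γ := (le_mult_iff ..).2 (Ideal.mul_mem_left _ a ((le_mult_iff ..).1 (hf P γ)))

/-- The score of a vector with respect to the multiplicity matrix `M`. -/
def score [Finite F] (M : Point F q → F → ℕ) (v : Point F q → F) : ℕ := ∑ P, M P (v P)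

/-- The `u`-weighted degree of `f = ∑ ψ_i z ^ i`: the maximum of `-v_{P_∞}(ψ_i) + u i`, where the
indices with `ψ_i = 0` contribute `-∞`. -/
def wdeg [Finite F] [Fact (Nat.card F = q ^ 2)] (u : ℕ) (f : (CoordRing F q)[X]) : WithBot ℤ :=
  f.support.sup fun i =>
    ((-vInfty F q (algebraMap _ (FunField F q) (f.coeff i)) + (u : ℤ) * i : ℤ) : WithBot ℤ)

end

end Hermitian

/-! Suppose `h = f(μ)` is nonzero and let `d` be its pole order at `P_∞`. Three estimates contradict
each other. The ultrametric inequality applied to `∑ ψ_i μ ^ i` gives `d ≤ deg_u(f)`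
(`le_wdeg_of_poleVal_eval`). Substituting `μ` for `z` carries the multiplicity conditions at the
points `(P, c_P)` to `h ∈ ∏ 𝔭_P ^ m_{P, c_P}`, where `𝔭_P` is the ideal of `P`
(`eval_mem_prod_ker_evalAt_pow`). Finally, zeros cannot outnumber poles, so `score ≤ d`
(`sum_le_of_mem_prod_ker_evalAt_pow`).

The last estimate is proved by counting dimensions, without the theory of divisors or Riemann–Roch.
Let `L_n` be the space of regular functions of pole order less than `n`. Then `L_0 = 0`, because the
monomials `x ^ i y ^ j` with `j < q` have distinct nonnegative pole orders (`one_le_poleVal`). Each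
step `L_n ⊆ L_{n+1}` adds at most one dimension, because the residue field at `P_∞` is `F`.
Multiplication by `h` embeds `L_n` in `L_{n+d}`, so `L_{n+d}` has image of dimension at most `d` in
`R/(h)`, and hence `dim R/(h) ≤ d`. On the other side, each prime factor in `∏ 𝔭_P ^ m_P` raises the
codimension by at least one. -/

theorem Valuation.exists_map_sum_eq {K Γ ι : Type*} [Ring K]
    [LinearOrderedCommGroupWithZero Γ] (v : Valuation K Γ) {s : Finset ι} (hs : s.Nonempty)
    (f : ι → K) (hf : Set.InjOn (fun i => v (f i)) s) :
    ∃ i ∈ s, v (∑ j ∈ s, f j) = v (f i) := by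
  classical
  obtain ⟨i, hi, hmax⟩ := s.exists_max_image (fun i => v (f i)) hs
  refine ⟨i, hi, v.map_sum_eq_of_lt hi fun j hj => ?_⟩
  rw [Finset.mem_sdiff, Finset.mem_singleton] at hj
  exact lt_of_le_of_ne (hmax j hj.1) fun h => hj.2 (hf hj.1 hi h)

namespace Hermitian

noncomputable section

/-! ### Pole orders at infinity and the residue field there -/

section Pole

variable (F : Type*) [Field F] (q : ℕ) [Finite F] [hF : Fact (Nat.card F = q ^ 2)]

/-- The valuation at infinity, restricted to the coordinate ring. -/
def poleVal : Valuation (CoordRing F q) ℤᵐ⁰ :=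
  (valInfty F q).comap (algebraMap (CoordRing F q) (FunField F q))

variable {F q}

lemma poleVal_ne_zero {r : CoordRing F q} (hr : r ≠ 0) : poleVal F q r ≠ 0 := by
  rw [poleVal, Valuation.comap_apply, Valuation.ne_zero_iff]
  simpa using hr

lemma poleVal_algebraMap {a : F} (ha : a ≠ 0) :
    poleVal F q (algebraMap F (CoordRing F q) a) = 1 := by
  have h : ∀ b : F, poleVal F q (algebraMap F (CoordRing F q) b) ≤ 1 := fun b => by
    change (origin F q).valuation (FunField F q) (chart F q (algebraMap _ _ (algebraMap F _ b))) ≤ 1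
    rw [← IsScalarTower.algebraMap_apply, AlgHom.commutes,
      IsScalarTower.algebraMap_apply F (CoordRing F q)]
    exact (origin F q).valuation_le_one _
  refine le_antisymm (h a) ?_
  have h1 : poleVal F q (algebraMap F (CoordRing F q) a) *
      poleVal F q (algebraMap F (CoordRing F q) a⁻¹) = 1 := by
    rw [← map_mul, ← map_mul, mul_inv_cancel₀ ha, map_one, map_one]
  rw [← h1]
  exact mul_le_of_le_one_right' (h a⁻¹)

lemma one_lt_poleVal_y : 1 < poleVal F q (y F q) := by
  have e : chart F q (algebraMap _ _ (y F q)) = 1 / algebraMap _ _ (y F q) := by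
    change IsFractionRing.lift (g := (chartHom F q).toRingHom) (chartHom_injective F q)
      (algebraMap _ _ _) = _
    rw [IsFractionRing.lift_algebraMap]
    exact liftHom_y _ _ _
  have h : (origin F q).valuation (FunField F q) (algebraMap _ _ (y F q)) < 1 := by
    rw [IsDedekindDomain.HeightOneSpectrum.valuation_lt_one_iff_mem]
    simp [origin, RingHom.mem_ker]
  change 1 < (origin F q).valuation (FunField F q) (chart F q (algebraMap _ _ (y F q)))
  rw [e, map_div₀, map_one, one_div]
  refine (one_lt_inv₀ ?_).2 h
  rw [Valuation.pos_iff]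
  simpa using y_ne_zero F q

variable (F q) in
-- The curve equation forces the pole orders of `x` and `y` into the ratio `q : (q + 1)`. The common
-- factor `a` is in fact 1, but positivity is enough for separating monomials.
lemma exists_poleVal_x_y : ∃ a : ℤ, 0 < a ∧ poleVal F q (x F q) = WithZero.exp (a * q) ∧
    poleVal F q (y F q) = WithZero.exp (a * (q + 1)) := by
  have hq := one_lt_q F q
  have hy0 := poleVal_ne_zero (y_ne_zero F q)
  have hx0 := poleVal_ne_zero (x_ne_zero F q)
  have hy := one_lt_poleVal_y (F := F) (q := q)
  have h := congrArg (poleVal F q) (curve_eq F q)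
  -- Since `y` has a pole, `y ^ q` dominates `y`, and the equation becomes `q * l = (q + 1) * k` for
  -- the pole orders `l` of `y` and `k` of `x`. The factor sought is `l - k`.
  rw [Valuation.map_add_eq_of_lt_left, map_pow, map_pow] at h
  swap
  · rw [map_pow]
    exact lt_self_pow₀ hy hq
  obtain ⟨l, hl⟩ : ∃ l, poleVal F q (y F q) = WithZero.exp l := ⟨_, (WithZero.exp_log hy0).symm⟩
  obtain ⟨k, hk⟩ : ∃ l, poleVal F q (x F q) = WithZero.exp l := ⟨_, (WithZero.exp_log hx0).symm⟩
  rw [hl, hk, ← WithZero.exp_nsmul, ← WithZero.exp_nsmul, WithZero.exp_inj] at h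
  rw [hl, ← WithZero.exp_zero, WithZero.exp_lt_exp] at hy
  simp only [nsmul_eq_mul] at h
  push_cast at h
  have hk' : k = (l - k) * q := by linear_combination -h
  refine ⟨l - k, ?_, ?_, ?_⟩
  · by_contra hneg
    have : k ≤ 0 := by
      rw [hk']; exact mul_nonpos_of_nonpos_of_nonneg (by omega) (by positivity)
    omega
  · rw [hk, ← hk']
  · rw [hl, WithZero.exp_inj]; linear_combination -h

/-- Distinct powers of `x` have distinct pole orders and nonzero constants have value 1, so no
cancellation between the monomials of `a` can occur. -/
lemma exists_poleVal_of {a : F[X]} (ha : a ≠ 0) :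
    ∃ i : ℕ, poleVal F q (AdjoinRoot.of (poly F q) a) = poleVal F q (x F q) ^ i := by
  obtain ⟨c, hc, hx, -⟩ := exists_poleVal_x_y F q
  have hq := one_lt_q F q
  have hterm : ∀ i ∈ a.support, poleVal F q
      (algebraMap F (CoordRing F q) (a.coeff i) * x F q ^ i) = poleVal F q (x F q) ^ i := by
    intro i hi
    rw [map_mul, poleVal_algebraMap (mem_support_iff.1 hi), one_mul, map_pow]
  have e : AdjoinRoot.of (poly F q) a
      = ∑ i ∈ a.support, algebraMap F (CoordRing F q) (a.coeff i) * x F q ^ i := by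
    conv_lhs => rw [a.as_sum_support_C_mul_X_pow]
    rw [map_sum]
    refine Finset.sum_congr rfl fun i _ => ?_
    rw [map_mul, map_pow]
    rfl
  obtain ⟨i, hi, h⟩ := (poleVal F q).exists_map_sum_eq (support_nonempty.2 ha)
    (fun i => algebraMap F (CoordRing F q) (a.coeff i) * x F q ^ i) (by
      intro i hi j hj hij
      simp only [hterm i hi, hterm j hj, hx, ← WithZero.exp_nsmul, WithZero.exp_inj,
        nsmul_eq_mul] at hij
      have : c * q ≠ 0 := by positivity
      exact_mod_cast mul_right_cancel₀ this hij)
  exact ⟨i, by rw [e, h, hterm i hi]⟩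

/-- A nonzero regular function on the affine curve has no zero at infinity. -/
lemma one_le_poleVal {r : CoordRing F q} (hr : r ≠ 0) : 1 ≤ poleVal F q r := by
  obtain ⟨c, hc, hx, hy⟩ := exists_poleVal_x_y F q
  have hq := one_lt_q F q
  obtain ⟨hd, hmonic⟩ := poly_natDegree F q hq
  obtain ⟨p, rfl⟩ := AdjoinRoot.mk_surjective r
  -- Pass to the representative of degree less than `q` in `y`; only then do the monomials have
  -- distinct pole orders.
  rw [← AdjoinRoot.mk_leftInverse hmonic (AdjoinRoot.mk (poly F q) p),
    AdjoinRoot.modByMonicHom_mk] at hr ⊢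
  set g := p %ₘ poly F q
  have hg : g ≠ 0 := fun h => hr (by rw [h, map_zero])
  have hgd : ∀ j ∈ g.support, j < q := by
    intro j hj
    have h1 : g.natDegree < q := by
      rw [← hd]
      exact natDegree_modByMonic_lt _ hmonic (by intro h; simp [h] at hd; omega)
    exact (le_natDegree_of_mem_supp j hj).trans_lt h1
  have hterm : ∀ j ∈ g.support, ∃ i : ℕ, poleVal F q
      (AdjoinRoot.of (poly F q) (g.coeff j) * y F q ^ j)
        = WithZero.exp (c * (i * q + j * (q + 1) : ℕ)) := by
    intro j hj
    obtain ⟨i, hi⟩ := exists_poleVal_of (q := q) (mem_support_iff.1 hj)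
    refine ⟨i, ?_⟩
    rw [map_mul, map_pow, hi, hx, hy, ← WithZero.exp_nsmul, ← WithZero.exp_nsmul,
      ← WithZero.exp_add]
    congr 1
    simp only [nsmul_eq_mul]
    push_cast
    ring
  have e : AdjoinRoot.mk (poly F q) g
      = ∑ j ∈ g.support, AdjoinRoot.of (poly F q) (g.coeff j) * y F q ^ j := by
    conv_lhs => rw [g.as_sum_support_C_mul_X_pow]
    rw [map_sum]
    refine Finset.sum_congr rfl fun i _ => ?_
    rw [map_mul, map_pow]
    rfl
  obtain ⟨j, hj, h⟩ := (poleVal F q).exists_map_sum_eq (support_nonempty.2 hg)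
    (fun j => AdjoinRoot.of (poly F q) (g.coeff j) * y F q ^ j) (by
      intro j hj k hk hjk
      obtain ⟨i, hi⟩ := hterm j hj
      obtain ⟨l, hl⟩ := hterm k hk
      simp only [hi, hl, WithZero.exp_inj] at hjk
      have h1 : i * q + j * (q + 1) = l * q + k * (q + 1) := by
        exact_mod_cast mul_left_cancel₀ hc.ne' hjk
      -- As `q + 1 ≡ 1` modulo `q`, the pole order determines the exponent of `y` modulo `q`.
      have h2 : j ≡ k [MOD q] := by
        have := congrArg (· % q) h1
        simpa [Nat.ModEq, mul_add, Nat.add_mod] using this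
      exact h2.eq_of_lt_of_lt (hgd j hj) (hgd k hk))
  obtain ⟨i, hi⟩ := hterm j hj
  rw [e, h, hi, ← WithZero.exp_zero, WithZero.exp_le_exp]
  positivity

/-- The residue field at the origin is `F`. -/
lemma exists_valuation_origin_sub_lt (g : FunField F q)
    (hg : (origin F q).valuation (FunField F q) g ≤ 1) :
    ∃ a : F, (origin F q).valuation (FunField F q) (g - algebraMap F _ a) < 1 := by
  set v := (origin F q).valuation (FunField F q)
  obtain ⟨a, b, hb, rfl⟩ := IsFractionRing.div_surjective (A := CoordRing F q) g
  have hb0 : b ≠ 0 := nonZeroDivisors.ne_zero hb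
  have hbK : algebraMap _ (FunField F q) b ≠ 0 := by simpa using hb0
  have hvb : v (algebraMap _ _ b) ≠ 0 := (Valuation.ne_zero_iff _).2 hbK
  rw [map_div₀, div_le_one₀ (zero_lt_iff.2 hvb)] at hg
  obtain ⟨n, hn⟩ : ∃ n : ℕ, v (algebraMap _ _ b) = WithZero.exp (-(n : ℤ)) :=
    ⟨_, ((origin F q).valuation_of_algebraMap b).trans
      ((origin F q).intValuation_eq_exp_neg_multiplicity hb0)⟩
  have hpow : ∀ (r : CoordRing F q) (m : ℕ),
      v (algebraMap _ _ r) ≤ WithZero.exp (-(m : ℤ)) ↔ r ∈ (origin F q).asIdeal ^ m := fun r m => by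
    rw [← (origin F q).intValuation_le_pow_iff_mem]
    exact iff_of_eq (congrArg (· ≤ _) ((origin F q).valuation_of_algebraMap r))
  -- With `n` the order of `b` at the origin `𝔭`, one has `𝔭 ^ n = (b) + 𝔭 ^ (n + 1)`. Writing `a =
  -- b * d + e` gives `a / b ≡ d`, and the residue of `d` is its value at the origin.
  obtain ⟨d, e, he, hde⟩ := Ideal.exists_mul_add_mem_pow_succ (origin F q).ne_bot b a
    ((hpow b n).1 hn.le)
    (fun h => by
      have := (hpow b (n + 1)).2 h
      rw [hn, WithZero.exp_le_exp] at this
      push_cast at this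
      omega)
    ((hpow a n).1 (hn ▸ hg))
  let φ : CoordRing F q →ₐ[F] F := liftHom (F := F) (q := q) (0 : F) 0
      (by simp [(zero_lt_one.trans (one_lt_q F q)).ne'])
  refine ⟨φ d, ?_⟩
  have e1 : algebraMap _ (FunField F q) a / algebraMap _ _ b - algebraMap F _ (φ d)
      = algebraMap _ _ e / algebraMap _ _ b
        + algebraMap _ _ (d - algebraMap F (CoordRing F q) (φ d)) := by
    rw [← hde, map_sub, IsScalarTower.algebraMap_apply F (CoordRing F q) (FunField F q)]
    simp only [map_add, map_mul]
    field_simp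
    ring
  rw [e1]
  refine Valuation.map_add_lt _ ?_ ?_
  · rw [map_div₀, div_lt_one₀ (zero_lt_iff.2 hvb), hn]
    refine ((hpow e (n + 1)).2 he).trans_lt ?_
    rw [WithZero.exp_lt_exp]
    push_cast
    omega
  · refine ((origin F q).valuation_lt_one_iff_mem _).2 ?_
    change φ _ = 0
    simp

/-- Cancellation of leading terms at infinity: the scalar is the residue of `g / f` at `P_∞`,
computed in the chart, which fixes constants. -/
lemma exists_poleVal_sub_smul_lt {f g : CoordRing F q} (hf : f ≠ 0)
    (hfg : poleVal F q g ≤ poleVal F q f) :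
    ∃ a : F, poleVal F q (g - a • f) < poleVal F q f := by
  have hfK : algebraMap _ (FunField F q) f ≠ 0 := by simpa using hf
  have hvf : 0 < poleVal F q f := zero_lt_iff.2 (poleVal_ne_zero hf)
  obtain ⟨a, ha⟩ := exists_valuation_origin_sub_lt
    (chart F q (algebraMap _ _ g / algebraMap _ _ f)) (by
      change valInfty F q _ ≤ 1
      rw [map_div₀]
      exact (div_le_one₀ hvf).2 hfg)
  refine ⟨a, ?_⟩
  rw [← AlgHom.commutes (chart F q), ← map_sub] at ha
  change valInfty F q _ < 1 at ha
  have e : algebraMap _ (FunField F q) (g - a • f)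
      = (algebraMap _ _ g / algebraMap _ _ f - algebraMap F _ a) * algebraMap _ _ f := by
    rw [Algebra.smul_def, map_sub, map_mul, ← IsScalarTower.algebraMap_apply]
    field_simp
  change valInfty F q (algebraMap _ _ (g - a • f)) < _
  rw [e, map_mul]
  exact mul_lt_of_lt_one_left hvf ha

end Pole

end

end Hermitian

/-! ### Dimension counts for subspaces and for ideal quotients -/

theorem Submodule.finite_and_finrank_le_add_one {K V : Type*} [Field K] [AddCommGroup V]
    [Module K V] {A B : Submodule K V} [FiniteDimensional K A]
    (h : ∀ f ∈ B, f ∉ A → ∀ g ∈ B, ∃ a : K, g - a • f ∈ A) :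
    FiniteDimensional K B ∧ Module.finrank K B ≤ Module.finrank K A + 1 := by
  by_cases hBA : B ≤ A
  · exact ⟨Submodule.finiteDimensional_of_le hBA, (Submodule.finrank_mono hBA).trans (by omega)⟩
  obtain ⟨f, hfB, hfA⟩ := SetLike.not_le_iff_exists.1 hBA
  have hle : B ≤ A ⊔ K ∙ f := fun g hg => by
    obtain ⟨a, ha⟩ := h f hfB hfA g hg
    rw [← sub_add_cancel g (a • f)]
    exact add_mem (Submodule.mem_sup_left ha)
      (Submodule.mem_sup_right (Submodule.smul_mem _ _ (Submodule.mem_span_singleton_self f)))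
  refine ⟨Submodule.finiteDimensional_of_le hle, (Submodule.finrank_mono hle).trans
    ((Submodule.finrank_add_le_finrank_add_finrank _ _).trans ?_)⟩
  gcongr
  exact (finrank_span_le_card ({f} : Set V)).trans (by simp)

/-- In a Dedekind domain over a field `K`, a product of `n` proper ideals has codimension at least
`n`, provided its quotient is finite-dimensional. -/
theorem Ideal.sum_le_finrank_quotient_prod_pow {K R ι : Type*} [Field K] [CommRing R]
    [IsDedekindDomain R] [Algebra K R] (P : ι → Ideal R) (hP : ∀ i, P i ≠ ⊤) (e : ι → ℕ)
    (s : Finset ι) (J : Ideal R) (hJ : J ≠ ⊥) (hle : J ≤ ∏ i ∈ s, P i ^ e i)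
    [FiniteDimensional K (R ⧸ J)] : ∑ i ∈ s, e i ≤ Module.finrank K (R ⧸ ∏ i ∈ s, P i ^ e i) := by
  -- Nonzero ideals cancel in a Dedekind domain, so `I * Q` is strictly smaller than `I` and `R ⧸ I
  -- * Q → R ⧸ I` has a nonzero kernel. The ideal `J` below makes the quotients finite-dimensional,
  -- which keeps `finrank` from taking its default value 0.
  have key : ∀ I Q : Ideal R, Q ≠ ⊤ → J ≤ I * Q →
      Module.finrank K (R ⧸ I) + 1 ≤ Module.finrank K (R ⧸ I * Q) := by
    intro I Q hQ hIQ
    have hI : I ≠ ⊥ := by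
      rintro rfl
      exact hJ (le_bot_iff.1 (by simpa using hIQ))
    have hlt : I * Q < I := by
      refine lt_of_le_of_ne Ideal.mul_le_left fun h => hQ ?_
      rw [← Ideal.one_eq_top]
      exact mul_left_cancel₀ hI (h.trans (mul_one I).symm)
    have : FiniteDimensional K (R ⧸ I * Q) :=
      Module.Finite.of_surjective (Ideal.Quotient.factorₐ K hIQ).toLinearMap
        (Ideal.Quotient.factor_surjective hIQ)
    let φ := (Ideal.Quotient.factorₐ K hlt.le).toLinearMap
    have hφ : Function.Surjective φ := Ideal.Quotient.factor_surjective hlt.le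
    have h1 := φ.finrank_range_add_finrank_ker
    rw [LinearMap.range_eq_top.2 hφ, finrank_top] at h1
    obtain ⟨r, hrI, hr⟩ := SetLike.exists_of_lt hlt
    have : 0 < Module.finrank K (LinearMap.ker φ) := by
      rw [Module.finrank_pos_iff_exists_ne_zero]
      refine ⟨⟨Ideal.Quotient.mk _ r, ?_⟩, fun h => hr ?_⟩
      · exact (Ideal.Quotient.eq_zero_iff_mem).2 hrI
      · exact (Ideal.Quotient.eq_zero_iff_mem).1 (congrArg Subtype.val h)
    omega
  have key2 : ∀ I Q : Ideal R, Q ≠ ⊤ → ∀ n, J ≤ I * Q ^ n →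
      Module.finrank K (R ⧸ I) + n ≤ Module.finrank K (R ⧸ I * Q ^ n) := by
    intro I Q hQ n
    induction n with
    | zero => intro _; rw [pow_zero, mul_one, add_zero]
    | succ n ih =>
      intro h
      rw [pow_succ, ← mul_assoc] at h ⊢
      have h1 := ih (h.trans Ideal.mul_le_left)
      have h2 := key _ Q hQ h
      omega
  classical
  induction s using Finset.induction_on with
  | empty => simp
  | insert i s hi ih =>
    rw [Finset.prod_insert hi, mul_comm] at hle ⊢
    rw [Finset.sum_insert hi]
    have h1 := ih (hle.trans Ideal.mul_le_left)
    have h2 := key2 _ _ (hP i) _ hle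
    omega

namespace Hermitian

noncomputable section

/-! ### The filtration by pole order and the count of zeros -/

section Pole

variable (F : Type*) [Field F] (q : ℕ) [Finite F] [hF : Fact (Nat.card F = q ^ 2)]

/-- The regular functions on the affine curve with a pole of order less than `n` at infinity. -/
def poleFiltration (n : ℕ) : Submodule F (CoordRing F q) where
  carrier := {r | poleVal F q r < WithZero.exp (n : ℤ)}
  zero_mem' := by simp
  add_mem' {f g} hf hg := (poleVal F q).map_add_lt (x := f) (y := g) hf hg
  smul_mem' a f hf := by
    rcases eq_or_ne a 0 with rfl | ha
    · simp
    · simpa [Algebra.smul_def, poleVal_algebraMap ha] using hf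

variable {F q}

lemma mem_poleFiltration {n : ℕ} {r : CoordRing F q} :
    r ∈ poleFiltration F q n ↔ poleVal F q r < WithZero.exp (n : ℤ) := Iff.rfl

lemma poleFiltration_mono : Monotone (poleFiltration F q) := fun m n hmn r hr => by
  rw [mem_poleFiltration] at hr ⊢
  exact hr.trans_le (by simpa using hmn)

lemma exists_mem_poleFiltration (r : CoordRing F q) : ∃ n, r ∈ poleFiltration F q n := by
  rcases eq_or_ne r 0 with rfl | hr
  · exact ⟨0, zero_mem _⟩
  refine ⟨(WithZero.log (poleVal F q r)).toNat + 1, ?_⟩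
  rw [mem_poleFiltration, ← WithZero.log_lt_iff_lt_exp (poleVal_ne_zero hr)]
  push_cast
  have := Int.self_le_toNat (WithZero.log (poleVal F q r))
  omega

variable (F q) in
-- The strict inequality in the definition makes stage 0 vanish instead of containing the constants.
-- This starts the induction for finite-dimensionality.
lemma poleFiltration_zero : poleFiltration F q 0 = ⊥ := by
  refine (Submodule.eq_bot_iff _).2 fun r hr => ?_
  by_contra h
  exact (one_le_poleVal h).not_gt (by simpa [mem_poleFiltration] using hr)

/-- A function in stage `n + 1` but not in stage `n` has pole order exactly `n`, so a multiple of it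
cancels the leading term of any other. This bounds each jump by one dimension. -/
lemma exists_sub_smul_mem_poleFiltration (n : ℕ) :
    ∀ f ∈ poleFiltration F q (n + 1), f ∉ poleFiltration F q n →
    ∀ g ∈ poleFiltration F q (n + 1), ∃ a : F, g - a • f ∈ poleFiltration F q n := by
  have hsucc : ∀ r ∈ poleFiltration F q (n + 1), poleVal F q r ≤ WithZero.exp (n : ℤ) := by
    intro r hr
    rcases eq_or_ne r 0 with rfl | hr0
    · simp
    rw [mem_poleFiltration, ← WithZero.log_lt_iff_lt_exp (poleVal_ne_zero hr0)] at hr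
    rw [← WithZero.log_le_iff_le_exp (poleVal_ne_zero hr0)]
    push_cast at hr
    omega
  intro f hf hfn g hg
  have hf0 : f ≠ 0 := by rintro rfl; exact hfn (zero_mem _)
  have hfv : poleVal F q f = WithZero.exp (n : ℤ) := le_antisymm (hsucc f hf) (not_lt.1 hfn)
  obtain ⟨a, ha⟩ := exists_poleVal_sub_smul_lt hf0 ((hsucc g hg).trans hfv.ge)
  exact ⟨a, ha.trans_eq hfv⟩

instance finiteDimensional_poleFiltration (n : ℕ) :
    FiniteDimensional F (poleFiltration F q n) := by
  induction n with
  | zero => rw [poleFiltration_zero]; infer_instance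
  | succ n ih =>
    exact (Submodule.finite_and_finrank_le_add_one (exists_sub_smul_mem_poleFiltration n)).1

lemma finrank_poleFiltration_add_le (n d : ℕ) :
    Module.finrank F (poleFiltration F q (n + d)) ≤ Module.finrank F (poleFiltration F q n) + d := by
  induction d with
  | zero => simp
  | succ d ih =>
    have := (Submodule.finite_and_finrank_le_add_one
      (exists_sub_smul_mem_poleFiltration (F := F) (q := q) (n + d))).2
    rw [← add_assoc]
    omega

/-- The image of `poleFiltration n` in the quotient by `h` has dimension at most the order of the
pole of `h` at infinity. -/
lemma finrank_map_poleFiltration_le {h : CoordRing F q} {d : ℕ} (hh : h ≠ 0)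
    (hd : poleVal F q h = WithZero.exp (d : ℤ)) (n : ℕ) :
    Module.finrank F ((poleFiltration F q (n + d)).map
      (Ideal.Quotient.mkₐ F (Ideal.span {h})).toLinearMap) ≤ d := by
  let π := (Ideal.Quotient.mkₐ F (Ideal.span {h})).toLinearMap
  let φ := π.domRestrict (poleFiltration F q (n + d))
  have h1 := φ.finrank_range_add_finrank_ker
  have h2 := finrank_poleFiltration_add_le (F := F) (q := q) n d
  rw [LinearMap.range_domRestrict] at h1
  have hmem : ∀ r ∈ poleFiltration F q n, h * r ∈ poleFiltration F q (n + d) := by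
    intro r hr
    rw [mem_poleFiltration] at hr ⊢
    rw [map_mul, hd, Nat.cast_add, add_comm, WithZero.exp_add]
    exact mul_lt_mul_of_pos_left hr WithZero.exp_pos
  -- Multiplication by `h` puts a copy of stage `n` in the kernel of reduction modulo `h` on stage
  -- `n + d`. By rank-nullity, what survives has dimension at most the growth between the two
  -- stages, which is at most `d`.
  let ψ : poleFiltration F q n →ₗ[F] LinearMap.ker φ :=
    (((LinearMap.mulLeft F h).restrict hmem)).codRestrict _ fun r => by
      change Ideal.Quotient.mk _ (h * (r : CoordRing F q)) = 0
      exact Ideal.Quotient.eq_zero_iff_mem.2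
        (Ideal.mul_mem_right _ _ (Ideal.mem_span_singleton_self h))
  have hψ : Function.Injective ψ := fun a b hab => Subtype.ext
    (mul_left_cancel₀ hh (congrArg (fun z => (z.1.1 : CoordRing F q)) hab))
  have h3 := LinearMap.finrank_le_finrank_of_injective hψ
  change Module.finrank F ((poleFiltration F q (n + d)).map π) ≤ d
  omega

/-- A function has at most as many zeros on the affine curve as it has poles at infinity. -/
lemma finite_and_finrank_quotient_le {h : CoordRing F q} {d : ℕ} (hh : h ≠ 0)
    (hd : poleVal F q h = WithZero.exp (d : ℤ)) :
    FiniteDimensional F (CoordRing F q ⧸ Ideal.span {h}) ∧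
      Module.finrank F (CoordRing F q ⧸ Ideal.span {h}) ≤ d := by
  let π := (Ideal.Quotient.mkₐ F (Ideal.span {h})).toLinearMap
  have hrank : Module.rank F (CoordRing F q ⧸ Ideal.span {h}) ≤ d := by
    -- The quotient is not yet known to be finite-dimensional, so finite independent sets are
    -- bounded instead: each lies in the image of a single stage.
    refine rank_le fun s hs => ?_
    have hex : ∀ z : CoordRing F q ⧸ Ideal.span {h}, ∃ n, z ∈ (poleFiltration F q n).map π := by
      intro z
      obtain ⟨r, rfl⟩ := Ideal.Quotient.mk_surjective z
      obtain ⟨n, hn⟩ := exists_mem_poleFiltration r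
      exact ⟨n, r, hn, rfl⟩
    choose N hN using hex
    have hsub : Submodule.span F (s : Set (CoordRing F q ⧸ Ideal.span {h}))
        ≤ (poleFiltration F q (s.sup N + d)).map π := by
      refine Submodule.span_le.2 fun z hz => ?_
      exact Submodule.map_mono (poleFiltration_mono ((Finset.le_sup hz).trans (by omega))) (hN z)
    rw [← finrank_span_finset_eq_card hs]
    exact (Submodule.finrank_mono hsub).trans (finrank_map_poleFiltration_le hh hd _)
  have hfin : FiniteDimensional F (CoordRing F q ⧸ Ideal.span {h}) :=
    Module.rank_lt_aleph0_iff.1 (hrank.trans_lt (Cardinal.natCast_lt_aleph0))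
  exact ⟨hfin, Module.finrank_le_of_rank_le hrank⟩

end Pole

/-! ### From multiplicity conditions to zeros and poles of `f(μ)` -/

section Interpolation

variable {F : Type*} [Field F] {q : ℕ}

/-- The section `z = μ` of `H × 𝔸¹` passes through `(P, μ(P))`, so restriction to it sends the
maximal ideal of that point into the ideal of `P`, and powers into powers. -/
lemma eval_mem_ker_evalAt_pow (P : Point F q) (μ : CoordRing F q) {f : (CoordRing F q)[X]} {m : ℕ}
    (hf : f ∈ maxIdeal P (evalAt P μ) ^ m) : f.eval μ ∈ RingHom.ker (evalAt P) ^ m := by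
  have hle : (maxIdeal P (evalAt P μ)).map (evalRingHom μ) ≤ RingHom.ker (evalAt P) := by
    refine Ideal.map_le_iff_le_comap.2 fun g hg => ?_
    have hg' : g.eval₂ (evalAt P : CoordRing F q →+* F) (evalAt P μ) = 0 := hg
    rw [Ideal.mem_comap, RingHom.mem_ker, ← hg']
    exact (eval₂_at_apply (evalAt P : CoordRing F q →+* F) μ).symm
  have := Ideal.mem_map_of_mem (evalRingHom μ) hf
  rw [Ideal.map_pow] at this
  exact Ideal.pow_right_mono hle m this

lemma ker_evalAt_injective : Function.Injective fun P : Point F q => RingHom.ker (evalAt P) := by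
  have hmem : ∀ (P Q : Point F q) (r : CoordRing F q),
      RingHom.ker (evalAt P) = RingHom.ker (evalAt Q) → evalAt Q r = evalAt P r := by
    intro P Q r h
    have : r - algebraMap F _ (evalAt P r) ∈ RingHom.ker (evalAt P) := by
      simp [RingHom.mem_ker]
    rw [h, RingHom.mem_ker, map_sub, AlgHom.commutes] at this
    exact sub_eq_zero.1 this
  intro P Q h
  have hx := hmem P Q (x F q) h
  have hy := hmem P Q (y F q) h
  simp only [evalAt, liftHom_x, liftHom_y] at hx hy
  exact Subtype.ext (Prod.ext hx.symm hy.symm)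

lemma ker_evalAt_isMaximal (P : Point F q) : (RingHom.ker (evalAt P)).IsMaximal :=
  RingHom.ker_isMaximal_of_surjective _ fun a => ⟨algebraMap F _ a, by simp⟩

/-- Distinct rational points have distinct maximal ideals, so their powers are pairwise coprime and
the product is the intersection of the local conditions. -/
lemma eval_mem_prod_ker_evalAt_pow [Finite F] {M : Point F q → F → ℕ} {f : (CoordRing F q)[X]}
    (hf : f ∈ interpIdeal M) (μ : CoordRing F q) :
    f.eval μ ∈ ∏ P : Point F q, RingHom.ker (evalAt P) ^ M P (ev F q μ P) := by
  rw [Ideal.prod_eq_iInf_of_pairwise_isCoprime]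
  · simp only [Ideal.mem_iInf]
    exact fun P _ => eval_mem_ker_evalAt_pow P μ ((le_mult_iff ..).1 (hf P _))
  · intro P _ Q _ hPQ
    have := ker_evalAt_isMaximal P
    have := ker_evalAt_isMaximal Q
    exact Ideal.isCoprime_iff_sup_eq.2 (Ideal.pow_sup_pow_eq_top
      (Ideal.IsMaximal.coprime_of_ne ‹_› ‹_› (ker_evalAt_injective.ne hPQ)))

variable [Finite F] [hF : Fact (Nat.card F = q ^ 2)]

/-- Cancellation can only lower the pole order, so some term `ψ_i μ ^ i` has a pole of order at
least `d`, and `μ ^ i` contributes at most `u * i` to it. -/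
lemma le_wdeg_of_poleVal_eval {u : ℕ} {f : (CoordRing F q)[X]} {μ : CoordRing F q}
    (hμ : poleVal F q μ ≤ WithZero.exp (u : ℤ)) {d : ℤ}
    (hd : poleVal F q (f.eval μ) = WithZero.exp d) : (d : WithBot ℤ) ≤ wdeg u f := by
  obtain ⟨i, hi, hle⟩ : ∃ i ∈ f.support,
      WithZero.exp d ≤ poleVal F q (f.coeff i * μ ^ i) := by
    by_contra! hcon
    rw [eval_eq_sum, sum_def] at hd
    exact (Valuation.map_sum_lt _ WithZero.exp_ne_zero hcon).ne hd
  refine le_trans ?_ (Finset.le_sup hi)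
  rw [WithBot.coe_le_coe, ← WithZero.exp_le_exp]
  have hc := poleVal_ne_zero (mem_support_iff.1 hi)
  refine hle.trans ?_
  rw [WithZero.exp_add, vInfty, neg_neg, map_mul, map_pow]
  refine mul_le_mul' (WithZero.exp_log hc).ge ((pow_le_pow_left' hμ i).trans_eq ?_)
  rw [← WithZero.exp_nsmul, nsmul_eq_mul, mul_comm]

/-- The number of zeros of a function on the affine curve, counted as prescribed multiplicities at
rational points, is at most the order of its pole at infinity. -/
lemma sum_le_of_mem_prod_ker_evalAt_pow {h : CoordRing F q} {d : ℕ} (hh : h ≠ 0)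
    (hd : poleVal F q h = WithZero.exp (d : ℤ)) (e : Point F q → ℕ)
    (hmem : h ∈ ∏ P : Point F q, RingHom.ker (evalAt P) ^ e P) : ∑ P, e P ≤ d := by
  obtain ⟨hfin, hrank⟩ := finite_and_finrank_quotient_le hh hd
  have hle := (Ideal.span_singleton_le_iff_mem _).2 hmem
  have hsum := Ideal.sum_le_finrank_quotient_prod_pow (K := F)
    (fun P : Point F q => RingHom.ker (evalAt P)) (fun P => (ker_evalAt_isMaximal P).ne_top) e
    Finset.univ _ (by simpa using hh) hle
  -- The codimension of the product of point ideals is compared with that of `(h)` through the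
  -- surjection from `R ⧸ (h)`.
  have hmono := LinearMap.finrank_le_finrank_of_surjective
    (f := (Ideal.Quotient.factorₐ F hle).toLinearMap) (Ideal.Quotient.factor_surjective hle)
  exact hsum.trans (hmono.trans hrank)

end Interpolation

end

end Hermitian

theorem mainTheorem1 (q : ℕ) (hq : IsPrimePow q) (F : Type*) [Field F] [Finite F]
    [Fact (Nat.card F = q ^ 2)] (u : ℕ) (hu : 0 < u) (M : Hermitian.Point F q → F → ℕ)
    (f : Polynomial (Hermitian.CoordRing F q)) (hf : f ∈ Hermitian.interpIdeal M) (hf0 : f ≠ 0)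
    (c : Hermitian.Point F q → F) (hc : c ∈ Hermitian.code F q u)
    (μ : Hermitian.CoordRing F q)
    (hμ : algebraMap (Hermitian.CoordRing F q) (Hermitian.FunField F q) μ
      ∈ Hermitian.LSpace F q u)
    (hcμ : c = Hermitian.ev F q μ)
    (hscore : Hermitian.wdeg u f < (((Hermitian.score M c : ℕ) : ℤ) : WithBot ℤ)) :
    f.eval μ = 0 := by
  by_contra hne
  -- The pole order is a natural number because a nonzero regular function cannot vanish at `P_∞`.
  obtain ⟨d, hd⟩ : ∃ d : ℕ, Hermitian.poleVal F q (f.eval μ) = WithZero.exp (d : ℤ) := by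
    have h0 := Hermitian.poleVal_ne_zero hne
    have h1 := Hermitian.one_le_poleVal hne
    rw [← WithZero.exp_log h0, ← WithZero.exp_zero, WithZero.exp_le_exp] at h1
    exact ⟨_, by rw [Int.toNat_of_nonneg h1, WithZero.exp_log h0]⟩
  have hμ' : Hermitian.poleVal F q μ ≤ WithZero.exp (u : ℤ) := hμ.2
  have hdeg := (Hermitian.le_wdeg_of_poleVal_eval hμ' hd).trans_lt hscore
  have hsum := Hermitian.sum_le_of_mem_prod_ker_evalAt_pow hne hd _
    (Hermitian.eval_mem_prod_ker_evalAt_pow hf μ)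
  rw [← hcμ] at hsum
  have hlt : d < Hermitian.score M c := by exact_mod_cast hdeg
  exact hlt.not_ge hsum
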